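/- Let $X_1,X_2,\dots$ be i.i.d. binary random variables with $0<p:=\Pr[X_i=1]\le\frac12$, and let $d_H$ denote Hamming distance. For real sequences $(D_n)_{n\ge1}$, $(D'_n)_{n\ge1}$, a rate $R\in\mathbb{R}$ is called $(D_n,D'_n)$-stably achievable if there are encoders $f_n:\{0,1\}^n\to\{0,1\}^{\lfloor nR\rfloor}$ and decoders $g_n:\{0,1\}^{\lfloor nR\rfloor}\to\{0,1\}^n$ ($n\ge1$; the floor is read as $0$ if $nR<0$) such that $\Pr[g_n(f_n(X^n))\ne X^n]\to0$ as $n\to\infty$ and such that, for every $n\ge1$ and all $x,\tilde x\in\{0,1\}^n$, $$d_H(x,\tilde x)\le D_n\ \Longrightarrow\ d_H(f_n(x),f_n(\tilde x))\le D'_n .$$ Write $h_2(x)=-x\log_2x-(1-x)\log_2(1-x)$ (with $0\log_2 0=0$) and, for $d_2\ge0$, $$\Psi(d_2,R)=\begin{cases}R\,h_2\!\big(\tfrac{d_2}{2R}\big),& d_2<R,\\ R,& d_2\ge R.\end{cases}$$ Theorem. Suppose $D_n/n\to d_1\ge0$ and $D'_n/n\to d_2\ge0$ (for instance $D_n=nd_1$,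 $D'_n=nd_2$), and $\frac{d_1}{2}<p$. Then every $(D_n,D'_n)$-stably achievable rate $R$ satisfies $$h_2(d_1/2)\le\Psi(d_2,R).$$ -/

import Mathlib

open Filter Topology MeasureTheory

noncomputable section

namespace StableCoding

/-- Binary entropy in base 2 (at the endpoints `0` and `1` this is `0`, as `Real.log 0 = 0`). -/
def h2 (x : ℝ) : ℝ := -x * Real.logb 2 x - (1 - x) * Real.logb 2 (1 - x)

/-- `Ψ(d₂, R) = R h₂(d₂ / (2R))` for `d₂ < R`, and `R` for `d₂ ≥ R`. -/
def Psi (d₂ R : ℝ) : ℝ := if d₂ < R then R * h2 (d₂ / (2 * R)) else R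

/-- Block distance on length-`n` source sequences induced by a per-letter distance `dI`. -/
def blockDist {𝒳 : Type} {n : ℕ} (dI : 𝒳 → 𝒳 → ℝ) (x x' : Fin n → 𝒳) : ℝ :=
  ∑ i, dI (x i) (x' i)

/-- The encoder `f` is `(D, D')`-stable: source sequences at distance at most `D` are mapped to
codewords at Hamming distance at most `D'`. -/
def IsStable {𝒳 : Type} {n l : ℕ} (dI : 𝒳 → 𝒳 → ℝ) (D D' : ℝ)
    (f : (Fin n → 𝒳) → (Fin l → Bool)) : Prop :=
  ∀ x x' : Fin n → 𝒳, blockDist dI x x' ≤ D → (hammingDist (f x) (f x') : ℝ) ≤ D'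

/-- Law of `X₁, …, Xₙ` drawn i.i.d. from `P`. -/
def sourceLaw {𝒳 : Type} [MeasurableSpace 𝒳] (P : PMF 𝒳) (n : ℕ) : Measure (Fin n → 𝒳) :=
  Measure.pi fun _ => P.toMeasure

/-- Decoding error probability `Pr[g(f(Xⁿ)) ≠ Xⁿ]`. -/
def errorProb {𝒳 : Type} [MeasurableSpace 𝒳] (P : PMF 𝒳) {n l : ℕ}
    (f : (Fin n → 𝒳) → (Fin l → Bool)) (g : (Fin l → Bool) → (Fin n → 𝒳)) : ℝ :=
  (sourceLaw P n).real {x | g (f x) ≠ x}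

/-- The rate `R` is `(Dₙ, D'ₙ)`-(stably) achievable for the i.i.d. source `P`: there are encoders
into binary strings of length `⌊nR⌋` and decoders, for all `n ≥ 1`, such that every encoder is
`(Dₙ, D'ₙ)`-stable and the decoding error probability tends to `0`. -/
def IsAchievable {𝒳 : Type} [MeasurableSpace 𝒳] (P : PMF 𝒳) (dI : 𝒳 → 𝒳 → ℝ)
    (D D' : ℕ → ℝ) (R : ℝ) : Prop :=
  ∃ (f : ∀ n : ℕ, (Fin n → 𝒳) → (Fin ⌊(n : ℝ) * R⌋₊ → Bool))
    (g : ∀ n : ℕ, (Fin ⌊(n : ℝ) * R⌋₊ → Bool) → (Fin n → 𝒳)),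
    (∀ n : ℕ, 1 ≤ n → IsStable dI (D n) (D' n) (f n)) ∧
    Tendsto (fun n : ℕ => errorProb P (f n) (g n)) atTop (𝓝 0)

/-- Per-letter Hamming distance on the binary alphabet. -/
def letterDist (a b : Bool) : ℝ := if a = b then 0 else 1

end StableCoding

end

/-! The encoder is injective on the correctly decoded set, whose mass tends to 1. If `δ < p ≤ 1/2`,
the Bernoulli(`p`) law is a mixture of translates of the Bernoulli(`δ`) law, so one translate gives
that set at least as much mass (`exists_center`). By concentration, about `2 ^ (n h₂(δ))` decoded
points then lie in one ball of relative radius slightly above `δ` (`exists_center_card_ge`).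

For `δ < d₁/2` the diameter of this ball is below `Dₙ`, so stability sends these points injectively
to codewords at mutual distance at most `D'ₙ`. Kleitman's bound (`card_le_of_hammingDist_le`) with
the entropy bound on binomial sums allows about `2 ^ (n R h₂(d₂/(2R)))` of them; if `d₂ ≥ R`, the
number of all codewords is used instead. Comparing exponents and letting `δ → d₁/2` gives the claim.
-/

namespace StableCoding

/-! ### Diameter bound in the cube, by rank over `𝔽₂` -/

section Diameter

variable {m : ℕ}

/-- The monomial `∏ i ∈ T, xᵢ` over `𝔽₂`. -/
def monomialF2 (T : Finset (Fin m)) (x : Fin m → Bool) : ZMod 2 :=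
  ∏ i ∈ T, (if x i then 1 else 0)

/-- The sum of `∏ i ∈ S, (xᵢ + yᵢ)` over all `S` with `#S ≤ D`. -/
def truncatedF2 (D : ℕ) (x y : Fin m → Bool) : ZMod 2 :=
  ∑ S : Finset (Fin m) with S.card ≤ D,
    ∏ i ∈ S, ((if x i then 1 else 0) + (if y i then 1 else 0) : ZMod 2)

/-- The product over `S` is the indicator that `x` and `y` differ on all of `S`. At distance at most
`D` the size cutoff is vacuous, so the sum counts all subsets of the difference set: `2 ^
hammingDist x y`, which is even unless `x = y`. -/
lemma truncatedF2_eq_ite {D : ℕ} {x y : Fin m → Bool} (h : hammingDist x y ≤ D) :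
    truncatedF2 D x y = if x = y then 1 else 0 := by
  classical
  have hb : ∀ a b : Bool, ((if a then 1 else 0) + (if b then 1 else 0) : ZMod 2)
      = if a ≠ b then 1 else 0 := by decide
  set d : Finset (Fin m) := Finset.univ.filter fun i => x i ≠ y i with hd
  have hdc : d.card = hammingDist x y := rfl
  have hP : ∀ S : Finset (Fin m),
      ∏ i ∈ S, ((if x i then 1 else 0) + (if y i then 1 else 0) : ZMod 2)
        = if S ⊆ d then 1 else 0 := by
    intro S
    simp only [hb]
    rw [Finset.prod_ite_zero]
    simp [hd, Finset.subset_iff]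
  unfold truncatedF2
  simp only [hP]
  rw [← Finset.sum_filter, Finset.filter_filter]
  have hS : (Finset.univ.filter fun S : Finset (Fin m) => S.card ≤ D ∧ S ⊆ d) = d.powerset := by
    ext S
    simp only [Finset.mem_filter, Finset.mem_univ, true_and, Finset.mem_powerset]
    exact ⟨fun h => h.2, fun hs => ⟨(Finset.card_le_card hs).trans (hdc ▸ h), hs⟩⟩
  rw [hS, Finset.sum_const, Finset.card_powerset, nsmul_eq_mul, mul_one, hdc]
  by_cases hxy : x = y
  · simp [hxy]
  · have : hammingDist x y ≠ 0 := by simpa using hxy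
    rw [if_neg hxy]
    push_cast
    have h2 : (2 : ZMod 2) = 0 := by decide
    rw [h2, zero_pow this]

/-- A low-rank factorization: when `#S ≤ D`, one of `T`, `S \ T` has at most `D / 2` elements. The
first sum collects the terms with small `x`-part; the second takes only the remaining ones, indexed
by their small `y`-part. -/
lemma truncatedF2_eq_split (D : ℕ) (x y : Fin m → Bool) :
    truncatedF2 D x y =
      (∑ T : {T : Finset (Fin m) // T.card ≤ D / 2}, monomialF2 T.1 x *
        ∑ S : Finset (Fin m) with S.card ≤ D ∧ T.1 ⊆ S, monomialF2 (S \ T.1) y) +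
      ∑ T : {T : Finset (Fin m) // T.card ≤ D / 2},
        (∑ S : Finset (Fin m) with S.card ≤ D ∧ T.1 ⊆ S ∧ ¬ (S \ T.1).card ≤ D / 2,
          monomialF2 (S \ T.1) x) * monomialF2 T.1 y := by
  classical
  have h1 : truncatedF2 D x y = ∑ S : Finset (Fin m) with S.card ≤ D,
      ∑ T ∈ S.powerset, monomialF2 T x * monomialF2 (S \ T) y := by
    unfold truncatedF2
    refine Finset.sum_congr rfl fun S _ => ?_
    rw [Finset.prod_add]
    rfl
  have h2 : ∀ S : Finset (Fin m), S.card ≤ D →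
      ∑ T ∈ S.powerset, monomialF2 T x * monomialF2 (S \ T) y =
      (∑ T ∈ S.powerset with T.card ≤ D / 2, monomialF2 T x * monomialF2 (S \ T) y) +
      ∑ T ∈ S.powerset with T.card ≤ D / 2 ∧ ¬ (S \ T).card ≤ D / 2,
        monomialF2 (S \ T) x * monomialF2 T y := by
    intro S hS
    rw [← Finset.sum_filter_add_sum_filter_not _ (fun T : Finset (Fin m) => T.card ≤ D / 2)]
    congr 1
    refine Finset.sum_nbij' (fun T => S \ T) (fun T => S \ T) ?_ ?_ ?_ ?_ ?_
    · intro T hT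
      simp only [Finset.mem_filter, Finset.mem_powerset] at hT ⊢
      have h3 := Finset.card_sdiff_add_card_eq_card hT.1
      refine ⟨Finset.sdiff_subset, by omega, ?_⟩
      rw [Finset.sdiff_sdiff_eq_self hT.1]
      exact hT.2
    · intro T hT
      simp only [Finset.mem_filter, Finset.mem_powerset] at hT ⊢
      exact ⟨Finset.sdiff_subset, hT.2.2⟩
    · intro T hT
      simp only [Finset.mem_filter, Finset.mem_powerset] at hT
      exact Finset.sdiff_sdiff_eq_self hT.1
    · intro T hT
      simp only [Finset.mem_filter, Finset.mem_powerset] at hT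
      exact Finset.sdiff_sdiff_eq_self hT.1
    · intro T hT
      simp only [Finset.mem_filter, Finset.mem_powerset] at hT
      rw [Finset.sdiff_sdiff_eq_self hT.1]
  rw [h1, Finset.sum_congr rfl fun S hS => h2 S (Finset.mem_filter.1 hS).2,
    Finset.sum_add_distrib]
  have hsub : ∀ φ : Finset (Fin m) → ZMod 2,
      ∑ T : {T : Finset (Fin m) // T.card ≤ D / 2}, φ T.1 =
        ∑ T : Finset (Fin m) with T.card ≤ D / 2, φ T := fun φ =>
    (Finset.sum_subtype (p := fun T : Finset (Fin m) => T.card ≤ D / 2)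
      (Finset.univ.filter fun T : Finset (Fin m) => T.card ≤ D / 2) (by simp) φ).symm
  congr 1
  · rw [hsub fun T => monomialF2 T x *
        ∑ S : Finset (Fin m) with S.card ≤ D ∧ T ⊆ S, monomialF2 (S \ T) y]
    simp only [Finset.mul_sum]
    refine Finset.sum_comm' ?_
    intro S T
    simp only [Finset.mem_filter, Finset.mem_univ, true_and, Finset.mem_powerset]
    tauto
  · rw [hsub fun T => (∑ S : Finset (Fin m) with S.card ≤ D ∧ T ⊆ S ∧ ¬ (S \ T).card ≤ D / 2,
          monomialF2 (S \ T) x) * monomialF2 T y]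
    simp only [Finset.sum_mul]
    refine Finset.sum_comm' ?_
    intro S T
    simp only [Finset.mem_filter, Finset.mem_univ, true_and, Finset.mem_powerset]
    tauto

lemma card_finset_card_le (m k : ℕ) :
    Fintype.card {T : Finset (Fin m) // T.card ≤ k} = ∑ i ∈ Finset.range (k + 1), m.choose i := by
  classical
  rw [Fintype.card_subtype,
    Finset.card_eq_sum_card_fiberwise (f := Finset.card) (t := Finset.range (k + 1))]
  · refine Finset.sum_congr rfl fun i hi => ?_
    rw [Finset.filter_filter]
    have : (Finset.univ.filter fun T : Finset (Fin m) => T.card ≤ k ∧ T.card = i)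
        = Finset.powersetCard i Finset.univ := by
      ext T
      simp only [Finset.mem_filter, Finset.mem_univ, true_and, Finset.mem_powersetCard,
        Finset.subset_univ]
      have := Finset.mem_range.1 hi
      omega
    rw [this, Finset.card_powersetCard, Finset.card_univ, Fintype.card_fin]
  · intro T hT
    have : T.card ≤ k := by simpa using hT
    simpa using Nat.lt_succ_of_le this

/-- Kleitman's diameter bound up to a factor `2`. -/
theorem card_le_of_hammingDist_le (D : ℕ) (A : Finset (Fin m → Bool))
    (hA : ∀ x ∈ A, ∀ y ∈ A, hammingDist x y ≤ D) :
    A.card ≤ 2 * ∑ i ∈ Finset.range (D / 2 + 1), m.choose i := by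
  classical
  let K := {T : Finset (Fin m) // T.card ≤ D / 2}
  let L : Matrix A (K ⊕ K) (ZMod 2) := fun x => Sum.elim (fun T => monomialF2 T.1 x.1)
    (fun T => ∑ S : Finset (Fin m) with S.card ≤ D ∧ T.1 ⊆ S ∧ ¬ (S \ T.1).card ≤ D / 2,
          monomialF2 (S \ T.1) x.1)
  let N : Matrix (K ⊕ K) A (ZMod 2) := fun k y => Sum.elim
    (fun T : K => ∑ S : Finset (Fin m) with S.card ≤ D ∧ T.1 ⊆ S, monomialF2 (S \ T.1) y.1)
    (fun T : K => monomialF2 T.1 y.1) k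
  -- The identity matrix on `A` factors through `K ⊕ K`, so its rank `#A` is at most `2 * #K`.
  have hLN : L * N = 1 := by
    ext x y
    rw [Matrix.mul_apply, Fintype.sum_sum_type, Matrix.one_apply]
    have h1 := truncatedF2_eq_split D x.1 y.1
    rw [truncatedF2_eq_ite (hA x.1 x.2 y.1 y.2)] at h1
    simp only [Subtype.ext_iff]
    exact h1.symm
  have hr : (L * N).rank ≤ Fintype.card (K ⊕ K) :=
    (Matrix.rank_mul_le_left L N).trans (Matrix.rank_le_card_width L)
  have : Fact (Nat.Prime 2) := ⟨Nat.prime_two⟩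
  rw [hLN, Matrix.rank_one, Fintype.card_sum, Fintype.card_coe, card_finset_card_le] at hr
  omega

/-! ### Binary entropy and binomial sums -/

lemma h2_eq_binEntropy (s : ℝ) : h2 s = Real.binEntropy s / Real.log 2 := by
  unfold h2 Real.binEntropy Real.logb
  rw [Real.log_inv, Real.log_inv]
  ring

lemma continuous_h2 : Continuous h2 := by
  have : h2 = fun s => Real.binEntropy s / Real.log 2 := funext h2_eq_binEntropy
  rw [this]
  exact Real.binEntropy_continuous.div_const _

lemma h2_nonneg {s : ℝ} (h0 : 0 ≤ s) (h1 : s ≤ 1) : 0 ≤ h2 s := by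
  rw [h2_eq_binEntropy]
  exact div_nonneg (Real.binEntropy_nonneg h0 h1) (Real.log_nonneg (by norm_num))

lemma two_rpow_neg_mul_h2 {s : ℝ} (h0 : 0 < s) (h1 : s < 1) (l : ℝ) :
    (2 : ℝ) ^ (-(l * h2 s)) = s ^ (l * s) * (1 - s) ^ (l * (1 - s)) := by
  have h2s : s = (2 : ℝ) ^ Real.logb 2 s := (Real.rpow_logb (by norm_num) (by norm_num) h0).symm
  have h2t : 1 - s = (2 : ℝ) ^ Real.logb 2 (1 - s) :=
    (Real.rpow_logb (by norm_num) (by norm_num) (by linarith)).symm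
  have e1 : s ^ (l * s) = (2 : ℝ) ^ (Real.logb 2 s * (l * s)) := by
    rw [Real.rpow_mul (by norm_num : (0 : ℝ) ≤ 2), ← h2s]
  have e2 : (1 - s) ^ (l * (1 - s)) = (2 : ℝ) ^ (Real.logb 2 (1 - s) * (l * (1 - s))) := by
    rw [Real.rpow_mul (by norm_num : (0 : ℝ) ≤ 2), ← h2t]
  rw [e1, e2, ← Real.rpow_add (by norm_num)]
  congr 1
  unfold h2
  ring

/-- For `i ≤ s l`, each weight `s ^ i (1 - s) ^ (l - i)` is at least `2 ^ (-l h₂(s))` because `s ≤ 1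
- s`, while the binomial weights sum to 1. -/
lemma sum_choose_le_two_rpow {l k : ℕ} {s : ℝ} (h0 : 0 < s) (h1 : s ≤ 1 / 2)
    (hk : (k : ℝ) ≤ s * l) :
    ((∑ i ∈ Finset.range (k + 1), l.choose i : ℕ) : ℝ) ≤ (2 : ℝ) ^ ((l : ℝ) * h2 s) := by
  have hkl : k ≤ l := by
    have : (k : ℝ) ≤ l := hk.trans (by nlinarith [(Nat.cast_nonneg l : (0 : ℝ) ≤ l)])
    exact_mod_cast this
  have hs1 : 0 < 1 - s := by linarith
  have hterm : ∀ i ∈ Finset.range (k + 1),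
      (2 : ℝ) ^ (-((l : ℝ) * h2 s)) * (l.choose i : ℝ) ≤ s ^ i * (1 - s) ^ (l - i) * l.choose i := by
    intro i hi
    have hik : i ≤ k := by simpa [Nat.lt_succ_iff] using hi
    have hiR : (i : ℝ) ≤ s * l := (Nat.cast_le.2 hik).trans hk
    refine mul_le_mul_of_nonneg_right ?_ (Nat.cast_nonneg _)
    rw [two_rpow_neg_mul_h2 h0 (by linarith), ← Real.rpow_natCast s, ← Real.rpow_natCast (1 - s),
      Nat.cast_sub (hik.trans hkl)]
    have e1 : s ^ ((l : ℝ) * s) = s ^ (i : ℝ) * s ^ ((l : ℝ) * s - i) := by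
      rw [← Real.rpow_add h0]; congr 1; ring
    have e2 : (1 - s) ^ ((l : ℝ) - i)
        = (1 - s) ^ ((l : ℝ) * (1 - s)) * (1 - s) ^ ((l : ℝ) * s - i) := by
      rw [← Real.rpow_add hs1]; congr 1; ring
    rw [e1, e2, mul_assoc, mul_comm (s ^ ((l : ℝ) * s - i))]
    have := Real.rpow_le_rpow h0.le (by linarith : s ≤ 1 - s)
      (by linarith [mul_comm s l] : 0 ≤ (l : ℝ) * s - i)
    gcongr
  have hsum : (2 : ℝ) ^ (-((l : ℝ) * h2 s)) * ((∑ i ∈ Finset.range (k + 1), l.choose i : ℕ) : ℝ)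
      ≤ 1 := by
    push_cast
    rw [Finset.mul_sum]
    calc _ ≤ ∑ i ∈ Finset.range (k + 1), s ^ i * (1 - s) ^ (l - i) * l.choose i :=
          Finset.sum_le_sum hterm
      _ ≤ ∑ i ∈ Finset.range (l + 1), s ^ i * (1 - s) ^ (l - i) * l.choose i :=
          Finset.sum_le_sum_of_subset_of_nonneg (by
            intro i; simp only [Finset.mem_range]; omega) (fun i _ _ => by positivity)
      _ = 1 := by rw [← add_pow]; simp
  rw [Real.rpow_neg (by norm_num), inv_mul_le_iff₀ (by positivity), mul_one] at hsum
  exact hsum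

end Diameter

end StableCoding

namespace StableCoding

/-! ### Bernoulli product laws and concentration -/

section Bernoulli

/-- Mass function of the Bernoulli distribution with parameter `δ`. -/
def bernoulliMass (δ : ℝ) (b : Bool) : ℝ := cond b δ (1 - δ)

/-- Mass function of the `n`-fold product of the Bernoulli distribution with parameter `δ`. -/
def bernoulliMassPi (δ : ℝ) {n : ℕ} (x : Fin n → Bool) : ℝ := ∏ i, bernoulliMass δ (x i)

lemma bernoulliMass_pos {δ : ℝ} (h0 : 0 < δ) (h1 : δ < 1) (b : Bool) : 0 < bernoulliMass δ b := by
  cases b <;> simp [bernoulliMass, h0, h1]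

lemma bernoulliMassPi_pos {δ : ℝ} (h0 : 0 < δ) (h1 : δ < 1) {n : ℕ} (x : Fin n → Bool) :
    0 < bernoulliMassPi δ x :=
  Finset.prod_pos fun i _ => bernoulliMass_pos h0 h1 (x i)

lemma sum_prod_coord {n : ℕ} (φ : Fin n → Bool → ℝ) :
    ∑ x : Fin n → Bool, ∏ i, φ i (x i) = ∏ i, ∑ b, φ i b := by
  rw [Finset.prod_univ_sum, Fintype.piFinset_univ]

lemma sum_bernoulliMassPi (δ : ℝ) (n : ℕ) : ∑ x : Fin n → Bool, bernoulliMassPi δ x = 1 := by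
  unfold bernoulliMassPi
  rw [sum_prod_coord fun _ => bernoulliMass δ]
  simp [bernoulliMass]

/-- Exponential upper tail bound for sums of i.i.d. functions of Bernoulli variables. -/
lemma exists_sum_bernoulliMassPi_tail_le {δ : ℝ} (h0 : 0 < δ) (h1 : δ < 1) (u : Bool → ℝ) {c : ℝ}
    (hc : ∑ b, bernoulliMass δ b * u b < c) :
    ∃ ρ : ℝ, 0 ≤ ρ ∧ ρ < 1 ∧ ∀ n : ℕ,
      ∑ x : Fin n → Bool with n * c ≤ ∑ i, u (x i), bernoulliMassPi δ x ≤ ρ ^ n := by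
  -- Chernoff's method: `g` is the moment generating function of `u - c`. Since `g 0 = 1` and `g' 0
  -- < 0`, some `t > 0` has `g t < 1`, and this value serves as `ρ`.
  set g : ℝ → ℝ := fun t => ∑ b, bernoulliMass δ b * Real.exp (t * (u b - c)) with hg
  have hg0 : g 0 = 1 := by simp [hg, bernoulliMass]
  have hd : HasDerivAt g (∑ b, bernoulliMass δ b * (u b - c)) 0 := by
    have : ∀ b ∈ (Finset.univ : Finset Bool),
        HasDerivAt (fun t : ℝ => bernoulliMass δ b * Real.exp (t * (u b - c)))
          (bernoulliMass δ b * (u b - c)) 0 := by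
      intro b _
      have h := (((hasDerivAt_id (0 : ℝ)).mul_const (u b - c)).exp).const_mul (bernoulliMass δ b)
      simpa using h
    exact HasDerivAt.fun_sum this
  have hneg : ∑ b, bernoulliMass δ b * (u b - c) < 0 := by
    have : ∑ b, bernoulliMass δ b * (u b - c) = ∑ b, bernoulliMass δ b * u b - c := by
      simp [bernoulliMass]; ring
    linarith
  obtain ⟨t, ht, htg⟩ : ∃ t : ℝ, 0 < t ∧ g t < 1 := by
    have h2 := (hasDerivAt_iff_tendsto_slope.1 hd).eventually (gt_mem_nhds hneg)
    have h3 : ∀ᶠ t in 𝓝[>] (0 : ℝ), slope g 0 t < 0 :=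
      h2.filter_mono (nhdsWithin_mono _ fun t (ht : 0 < t) => ht.ne')
    obtain ⟨t, h4, h5⟩ := (h3.and self_mem_nhdsWithin).exists
    have h5 : 0 < t := h5
    refine ⟨t, h5, ?_⟩
    rw [slope_def_field, hg0, sub_zero, div_lt_iff₀ h5] at h4
    linarith
  refine ⟨g t, Finset.sum_nonneg fun b _ =>
    mul_nonneg (bernoulliMass_pos h0 h1 b).le (Real.exp_pos _).le, htg, fun n => ?_⟩
  have hpow : ∑ x : Fin n → Bool, bernoulliMassPi δ x * Real.exp (t * (∑ i, u (x i) - n * c))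
      = g t ^ n := by
    have : ∀ x : Fin n → Bool,
        bernoulliMassPi δ x * Real.exp (t * (∑ i, u (x i) - n * c))
          = ∏ i, (bernoulliMass δ (x i) * Real.exp (t * (u (x i) - c))) := by
      intro x
      rw [Finset.prod_mul_distrib, ← Real.exp_sum, ← Finset.mul_sum, Finset.sum_sub_distrib]
      simp [bernoulliMassPi]
    simp only [this]
    rw [sum_prod_coord fun _ b => bernoulliMass δ b * Real.exp (t * (u b - c))]
    simp [hg]
  rw [← hpow]
  calc _ ≤ ∑ x : Fin n → Bool with n * c ≤ ∑ i, u (x i),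
        bernoulliMassPi δ x * Real.exp (t * (∑ i, u (x i) - n * c)) := by
        refine Finset.sum_le_sum fun x hx => ?_
        have hx := (Finset.mem_filter.1 hx).2
        exact le_mul_of_one_le_right (bernoulliMassPi_pos h0 h1 x).le
          (Real.one_le_exp (mul_nonneg ht.le (by linarith)))
    _ ≤ _ := Finset.sum_le_sum_of_subset_of_nonneg (Finset.filter_subset _ _) fun x _ _ =>
        mul_nonneg (bernoulliMassPi_pos h0 h1 x).le (Real.exp_pos _).le

/-- Adding Bernoulli noise to a Bernoulli sequence gives a Bernoulli sequence. -/
lemma sum_bernoulliMassPi_mul_xor {p q δ : ℝ} (h : q * (1 - δ) + (1 - q) * δ = p) {n : ℕ}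
    (x : Fin n → Bool) :
    ∑ y : Fin n → Bool, bernoulliMassPi q y * bernoulliMassPi δ (fun i => x i ^^ y i)
      = bernoulliMassPi p x := by
  have : ∀ y : Fin n → Bool,
      bernoulliMassPi q y * bernoulliMassPi δ (fun i => x i ^^ y i)
        = ∏ i, (bernoulliMass q (y i) * bernoulliMass δ (x i ^^ y i)) := fun y =>
    Finset.prod_mul_distrib.symm
  simp only [this]
  rw [sum_prod_coord fun i b => bernoulliMass q b * bernoulliMass δ (x i ^^ b)]
  refine Finset.prod_congr rfl fun i _ => ?_
  cases x i
  · simp [bernoulliMass, ← h]; ring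
  · simp [bernoulliMass, ← h]

/-- Some translate of the Bernoulli(`δ`) product law gives a set at least as much mass as the
Bernoulli(`p`) product law does, if `δ < p ≤ 1/2`. -/
lemma exists_center {p δ : ℝ} (hδ : δ < p) (hp : p ≤ 1 / 2) {n : ℕ}
    (A : Finset (Fin n → Bool)) :
    ∃ y : Fin n → Bool, ∑ x ∈ A, bernoulliMassPi p x
      ≤ ∑ x ∈ A, bernoulliMassPi δ (fun i => x i ^^ y i) := by
  have h2 : 0 < 1 - 2 * δ := by linarith
  -- The noise level for which Bernoulli(`q`) xor Bernoulli(`δ`) is Bernoulli(`p`). Averaging over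
  -- `y` drawn from Bernoulli(`q`) then rules out that every translate has smaller mass.
  set q := (p - δ) / (1 - 2 * δ) with hq
  have hq0 : 0 < q := div_pos (by linarith) h2
  have hq1 : q < 1 := (div_lt_one h2).2 (by linarith)
  have hqp : q * (1 - δ) + (1 - q) * δ = p := by
    have : q * (1 - 2 * δ) = p - δ := div_mul_cancel₀ _ h2.ne'
    linarith
  by_contra! hcon
  have hlt : ∑ y : Fin n → Bool, bernoulliMassPi q y *
        ∑ x ∈ A, bernoulliMassPi δ (fun i => x i ^^ y i)
      < ∑ y : Fin n → Bool, bernoulliMassPi q y * ∑ x ∈ A, bernoulliMassPi p x :=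
    Finset.sum_lt_sum_of_nonempty Finset.univ_nonempty fun y _ =>
      mul_lt_mul_of_pos_left (hcon y) (bernoulliMassPi_pos hq0 hq1 y)
  rw [← Finset.sum_mul, sum_bernoulliMassPi, one_mul] at hlt
  simp only [Finset.mul_sum] at hlt
  rw [Finset.sum_comm] at hlt
  simp only [sum_bernoulliMassPi_mul_xor hqp] at hlt
  exact lt_irrefl _ hlt

lemma hammingDist_eq_sum_xor {n : ℕ} (x y : Fin n → Bool) :
    (hammingDist x y : ℝ) = ∑ i, if (x i ^^ y i) then (1 : ℝ) else 0 := by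
  rw [Finset.sum_boole]
  simp [hammingDist]

lemma bernoulliMassPi_eq_two_rpow {δ : ℝ} (h0 : 0 < δ) (h1 : δ < 1) {n : ℕ} (z : Fin n → Bool) :
    bernoulliMassPi δ z = (2 : ℝ) ^ (∑ i, Real.logb 2 (bernoulliMass δ (z i))) := by
  rw [Real.rpow_sum_of_pos (by norm_num)]
  exact Finset.prod_congr rfl fun i _ =>
    (Real.rpow_logb (by norm_num) (by norm_num) (bernoulliMass_pos h0 h1 _)).symm

/-- A set of mass `μ` under the Bernoulli(`p`) product law has about `μ 2 ^ (n h₂(δ))` points in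
some Hamming ball of relative radius slightly more than `δ`. -/
lemma exists_center_card_ge {p δ s η : ℝ} (h0 : 0 < δ) (hδ : δ < p) (hp : p ≤ 1 / 2)
    (hs : δ < s) (hη : 0 < η) :
    ∃ ε : ℕ → ℝ, Tendsto ε atTop (𝓝 0) ∧ ∀ (n : ℕ) (A : Finset (Fin n → Bool)),
      ∃ y : Fin n → Bool, ∑ x ∈ A, bernoulliMassPi p x - ε n ≤
        (A.filter fun x => (hammingDist x y : ℝ) < n * s).card *
          (2 : ℝ) ^ (-((n : ℝ) * (h2 δ - η))) := by
  have h1 : δ < 1 := by linarith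
  obtain ⟨ρ₁, hρ₁, hρ₁', ht₁⟩ := exists_sum_bernoulliMassPi_tail_le h0 h1
    (fun b => if b then 1 else 0) (c := s) (by simpa [bernoulliMass] using hs)
  -- The mean of the log-mass is `-h2 δ`, so points heavier than the threshold are exponentially
  -- rare.
  obtain ⟨ρ₂, hρ₂, hρ₂', ht₂⟩ := exists_sum_bernoulliMassPi_tail_le h0 h1
    (fun b => Real.logb 2 (bernoulliMass δ b)) (c := -(h2 δ - η)) (by
      simp only [Fintype.sum_bool, bernoulliMass, cond_true, cond_false, h2]; linarith)
  refine ⟨fun n => ρ₁ ^ n + ρ₂ ^ n, ?_, fun n A => ?_⟩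
  · simpa using (tendsto_pow_atTop_nhds_zero_of_lt_one hρ₁ hρ₁').add
      (tendsto_pow_atTop_nhds_zero_of_lt_one hρ₂ hρ₂')
  obtain ⟨y, hy⟩ := exists_center hδ hp A
  refine ⟨y, ?_⟩
  have hinj : Function.Injective fun (x : Fin n → Bool) (i : Fin n) => x i ^^ y i := by
    intro x x' h
    funext i
    simpa using congrFun h i
  have htail : ∀ Q : (Fin n → Bool) → Prop, ∀ [DecidablePred Q],
      ∑ x ∈ A with Q (fun i => x i ^^ y i), bernoulliMassPi δ (fun i => x i ^^ y i)
        ≤ ∑ z with Q z, bernoulliMassPi δ z := by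
    intro Q _
    rw [← Finset.sum_image (f := fun z => bernoulliMassPi δ z)
      (g := fun (x : Fin n → Bool) (i : Fin n) => x i ^^ y i) hinj.injOn]
    refine Finset.sum_le_sum_of_subset_of_nonneg ?_ fun z _ _ => (bernoulliMassPi_pos h0 h1 z).le
    intro z hz
    obtain ⟨x, hx, rfl⟩ := Finset.mem_image.1 hz
    exact Finset.mem_filter.2 ⟨Finset.mem_univ _, (Finset.mem_filter.1 hx).2⟩
  have e₁ := (htail (fun z => (n : ℝ) * s ≤ ∑ i, if z i then (1 : ℝ) else 0)).trans (ht₁ n)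
  have e₂ := (htail (fun z => (n : ℝ) * (-(h2 δ - η)) ≤
    ∑ i, Real.logb 2 (bernoulliMass δ (z i)))).trans (ht₂ n)
  -- Each point is near `y` and light, or far from `y`, or atypically heavy; the last two cases are
  -- paid for by the tails.
  have hpt : ∀ x ∈ A, bernoulliMassPi δ (fun i => x i ^^ y i) ≤
      (if (hammingDist x y : ℝ) < n * s then (2 : ℝ) ^ (-((n : ℝ) * (h2 δ - η))) else 0) +
      (if (n : ℝ) * s ≤ ∑ i, (if (x i ^^ y i) then (1 : ℝ) else 0) then
        bernoulliMassPi δ (fun i => x i ^^ y i) else 0) +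
      (if (n : ℝ) * (-(h2 δ - η)) ≤ ∑ i, Real.logb 2 (bernoulliMass δ (x i ^^ y i)) then
        bernoulliMassPi δ (fun i => x i ^^ y i) else 0) := by
    intro x _
    have hpos := bernoulliMassPi_pos h0 h1 (fun i => x i ^^ y i)
    have h2pos : (0 : ℝ) < (2 : ℝ) ^ (-((n : ℝ) * (h2 δ - η))) := by positivity
    rw [← hammingDist_eq_sum_xor]
    by_cases ha : (n : ℝ) * s ≤ hammingDist x y
    · rw [if_neg (not_lt.2 ha), if_pos ha]
      split_ifs <;> linarith
    · rw [if_pos (not_le.1 ha), if_neg ha]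
      split_ifs with hb
      · linarith
      · rw [add_zero, add_zero, bernoulliMassPi_eq_two_rpow h0 h1]
        exact Real.rpow_le_rpow_of_exponent_le (by norm_num) (by push Not at hb; linarith)
  have hsum := Finset.sum_le_sum hpt
  rw [Finset.sum_add_distrib, Finset.sum_add_distrib, ← Finset.sum_filter, ← Finset.sum_filter,
    ← Finset.sum_filter, Finset.sum_const, nsmul_eq_mul] at hsum
  linarith

end Bernoulli

end StableCoding

namespace StableCoding

/-! ### From achievability to the entropy inequality -/

section Converse

lemma toReal_eq_bernoulliMass {P : PMF Bool} {p : ℝ} (hP : (P true).toReal = p) (b : Bool) :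
    (P b).toReal = bernoulliMass p b := by
  have h := P.tsum_coe
  rw [tsum_fintype, Fintype.sum_bool] at h
  have h' := congrArg ENNReal.toReal h
  rw [ENNReal.toReal_add (P.apply_ne_top _) (P.apply_ne_top _), hP] at h'
  cases b
  · simp only [bernoulliMass, cond_false]
    simp only [ENNReal.toReal_one] at h'
    linarith
  · simpa [bernoulliMass] using hP

lemma sourceLaw_real_eq_sum {P : PMF Bool} {p : ℝ} (hP : (P true).toReal = p) {n : ℕ}
    (A : Finset (Fin n → Bool)) :
    (sourceLaw P n).real (A : Set (Fin n → Bool)) = ∑ x ∈ A, bernoulliMassPi p x := by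
  unfold sourceLaw
  rw [← sum_measureReal_singleton]
  refine Finset.sum_congr rfl fun x _ => ?_
  rw [measureReal_def, Measure.pi_singleton, ENNReal.toReal_prod]
  refine Finset.prod_congr rfl fun i _ => ?_
  rw [PMF.toMeasure_apply_singleton _ _ (measurableSet_singleton _), toReal_eq_bernoulliMass hP]

/-- The set of source sequences that are decoded correctly. -/
def decodedSet {n l : ℕ} (f : (Fin n → Bool) → (Fin l → Bool))
    (g : (Fin l → Bool) → (Fin n → Bool)) : Finset (Fin n → Bool) :=
  Finset.univ.filter fun x => g (f x) = x

lemma sum_decodedSet {P : PMF Bool} {p : ℝ} (hP : (P true).toReal = p) {n l : ℕ}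
    (f : (Fin n → Bool) → (Fin l → Bool)) (g : (Fin l → Bool) → (Fin n → Bool)) :
    ∑ x ∈ decodedSet f g, bernoulliMassPi p x = 1 - errorProb P f g := by
  have h : {x | g (f x) ≠ x} = ((Finset.univ.filter fun x => ¬ g (f x) = x :
      Finset (Fin n → Bool)) : Set (Fin n → Bool)) := by
    ext x; simp
  unfold errorProb
  rw [h, sourceLaw_real_eq_sum hP, ← sum_bernoulliMassPi p n,
    ← Finset.sum_filter_add_sum_filter_not Finset.univ (fun x => g (f x) = x)]
  simp [decodedSet]

lemma injOn_decodedSet {n l : ℕ} (f : (Fin n → Bool) → (Fin l → Bool))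
    (g : (Fin l → Bool) → (Fin n → Bool)) :
    Set.InjOn f (decodedSet f g : Set (Fin n → Bool)) := by
  intro x hx y hy h
  have hx : g (f x) = x := by simpa [decodedSet] using hx
  have hy : g (f y) = y := by simpa [decodedSet] using hy
  rw [← hx, ← hy, h]

lemma blockDist_letterDist {n : ℕ} (x y : Fin n → Bool) :
    blockDist letterDist x y = hammingDist x y := by
  rw [hammingDist_eq_sum_xor]
  refine Finset.sum_congr rfl fun i _ => ?_
  unfold letterDist
  cases x i <;> cases y i <;> simp

/-- Achievable rates of a nondegenerate source are positive. -/
lemma IsAchievable.rate_pos {P : PMF Bool} {p : ℝ} (hP : (P true).toReal = p) (hp0 : 0 < p)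
    (hp : p ≤ 1 / 2) {dI : Bool → Bool → ℝ} {D D' : ℕ → ℝ} {R : ℝ}
    (hR : IsAchievable P dI D D' R) : 0 < R := by
  obtain ⟨f, g, -, herr⟩ := hR
  by_contra! hR0
  -- With codewords of length 0 at most one sequence is decoded, and since `p ≤ 1/2` no sequence has
  -- mass above `(1 - p) ^ n`.
  have hle : ∀ n : ℕ, 1 - errorProb P (f n) (g n) ≤ (1 - p) ^ n := by
    intro n
    have hl : ⌊(n : ℝ) * R⌋₊ = 0 :=
      Nat.floor_of_nonpos (mul_nonpos_of_nonneg_of_nonpos (Nat.cast_nonneg n) hR0)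
    have hsub : Subsingleton (Fin ⌊(n : ℝ) * R⌋₊ → Bool) := by
      rw [hl]; infer_instance
    have hcard : (decodedSet (f n) (g n)).card ≤ 1 :=
      Finset.card_le_one.2 fun x hx y hy =>
        injOn_decodedSet _ _ hx hy (Subsingleton.elim _ _)
    have hmass : ∀ x : Fin n → Bool, bernoulliMassPi p x ≤ (1 - p) ^ n := by
      intro x
      have : bernoulliMassPi p x ≤ ∏ _i : Fin n, (1 - p) :=
        Finset.prod_le_prod (fun i _ => (bernoulliMass_pos hp0 (by linarith) _).le) fun i _ => by
          cases x i <;> simp [bernoulliMass]; linarith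
      simpa using this
    rw [← sum_decodedSet hP]
    refine (Finset.sum_le_card_nsmul _ _ _ fun x _ => hmass x).trans ?_
    rw [nsmul_eq_mul]
    exact mul_le_of_le_one_left (pow_nonneg (by linarith) _) (by exact_mod_cast hcard)
  have hlim := le_of_tendsto_of_tendsto' (herr.const_sub 1)
    (tendsto_pow_atTop_nhds_zero_of_lt_one (by linarith : 0 ≤ 1 - p) (by linarith)) hle
  linarith

/-- If codeword sets of diameter at most `D'ₙ` have size at most `2 · 2 ^ (nK)` eventually, then
every `δ < d₁/2` satisfies `h₂(δ) ≤ K`. -/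
lemma h2_le_of_eventually_card_le {P : PMF Bool} {p : ℝ} (hP : (P true).toReal = p)
    (hp : p ≤ 1 / 2) {d₁ R K δ : ℝ} {D D' : ℕ → ℝ}
    (hD : Tendsto (fun n : ℕ => D n / (n : ℝ)) atTop (𝓝 d₁)) (hd₁p : d₁ / 2 < p)
    (hR : IsAchievable P letterDist D D' R) (hδ0 : 0 < δ) (hδ : δ < d₁ / 2)
    (hK : ∀ᶠ n : ℕ in atTop, ∀ B : Finset (Fin ⌊(n : ℝ) * R⌋₊ → Bool),
      (∀ x ∈ B, ∀ y ∈ B, (hammingDist x y : ℝ) ≤ D' n) →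
        (B.card : ℝ) ≤ 2 * (2 : ℝ) ^ ((n : ℝ) * K)) :
    h2 δ ≤ K := by
  obtain ⟨f, g, hst, herr⟩ := hR
  refine le_of_forall_pos_le_add fun η hη => ?_
  obtain ⟨s, hs, hs'⟩ := exists_between hδ
  obtain ⟨ε, hε, hcenter⟩ := exists_center_card_ge hδ0 (hδ.trans hd₁p) hp hs hη
  have h1 : ∀ᶠ n : ℕ in atTop, errorProb P (f n) (g n) + ε n < 1 / 2 := by
    have := herr.add hε
    rw [add_zero] at this
    exact this.eventually (gt_mem_nhds (by norm_num))
  have h2' : ∀ᶠ n : ℕ in atTop, 2 * s < D n / n := hD.eventually (lt_mem_nhds (by linarith))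
  -- The 4 combines the factor 2 in `hK` with the lower bound `1/2` on the remaining decoded mass.
  have hmain : ∀ᶠ n : ℕ in atTop, (2 : ℝ) ^ ((n : ℝ) * (h2 δ - η - K)) ≤ 4 := by
    filter_upwards [h1, h2', hK, eventually_ge_atTop 1] with n h1 h2' hK hn
    have hn0 : (0 : ℝ) < n := by exact_mod_cast hn
    rw [lt_div_iff₀ hn0] at h2'
    obtain ⟨y, hy⟩ := hcenter n (decodedSet (f n) (g n))
    rw [sum_decodedSet hP] at hy
    set G := (decodedSet (f n) (g n)).filter fun x => (hammingDist x y : ℝ) < n * s with hG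
    have hinj : Set.InjOn (f n) (G : Set (Fin n → Bool)) :=
      (injOn_decodedSet (f n) (g n)).mono (by
        intro x hx
        exact (Finset.mem_filter.1 (Finset.mem_coe.1 hx)).1)
    have hB := hK (G.image (f n)) (by
      intro a ha b hb
      obtain ⟨x, hx, rfl⟩ := Finset.mem_image.1 ha
      obtain ⟨x', hx', rfl⟩ := Finset.mem_image.1 hb
      refine hst n hn x x' ?_
      rw [blockDist_letterDist]
      have hx := (Finset.mem_filter.1 hx).2
      have hx' := (Finset.mem_filter.1 hx').2
      have htri : (hammingDist x x' : ℝ) ≤ hammingDist x y + hammingDist x' y := by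
        have := hammingDist_triangle x y x'
        rw [hammingDist_comm y x'] at this
        exact_mod_cast this
      linarith)
    rw [Finset.card_image_of_injOn hinj] at hB
    have hpow : (2 : ℝ) ^ ((n : ℝ) * (h2 δ - η - K)) * (2 : ℝ) ^ ((n : ℝ) * K) *
        (2 : ℝ) ^ (-((n : ℝ) * (h2 δ - η))) = 1 := by
      rw [← Real.rpow_add (by norm_num), ← Real.rpow_add (by norm_num)]
      ring_nf
      exact Real.rpow_zero 2
    have hle : 1 ≤ 4 * ((2 : ℝ) ^ ((n : ℝ) * K) * (2 : ℝ) ^ (-((n : ℝ) * (h2 δ - η)))) := by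
      have := mul_le_mul_of_nonneg_right hB
        (by positivity : (0 : ℝ) ≤ (2 : ℝ) ^ (-((n : ℝ) * (h2 δ - η))))
      linarith
    have := mul_le_mul_of_nonneg_left hle
      (by positivity : (0 : ℝ) ≤ (2 : ℝ) ^ ((n : ℝ) * (h2 δ - η - K)))
    linarith
  by_contra! hcon
  have ht : Tendsto (fun n : ℕ => (2 : ℝ) ^ ((n : ℝ) * (h2 δ - η - K))) atTop atTop :=
    (tendsto_rpow_atTop_of_base_gt_one 2 (by norm_num)).comp
      (tendsto_natCast_atTop_atTop.atTop_mul_const (by linarith))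
  obtain ⟨n, h4, h5⟩ := (hmain.and (ht.eventually_gt_atTop 4)).exists
  linarith

lemma card_le_two_rpow_rate {R : ℝ} (hR : 0 < R) (n : ℕ)
    (B : Finset (Fin ⌊(n : ℝ) * R⌋₊ → Bool)) :
    (B.card : ℝ) ≤ 2 * (2 : ℝ) ^ ((n : ℝ) * R) := by
  have h1 : B.card ≤ 2 ^ ⌊(n : ℝ) * R⌋₊ := by simpa using B.card_le_univ
  have h2 : (2 : ℝ) ^ ⌊(n : ℝ) * R⌋₊ ≤ (2 : ℝ) ^ ((n : ℝ) * R) := by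
    rw [← Real.rpow_natCast]
    exact Real.rpow_le_rpow_of_exponent_le (by norm_num) (Nat.floor_le (by positivity))
  have h3 : (B.card : ℝ) ≤ 2 ^ ⌊(n : ℝ) * R⌋₊ := by exact_mod_cast h1
  have : (0 : ℝ) < (2 : ℝ) ^ ((n : ℝ) * R) := by positivity
  linarith

lemma eventually_card_le_two_rpow_h2 {R d₂ s : ℝ} {D' : ℕ → ℝ} (hR : 0 < R) (hd₂ : 0 ≤ d₂)
    (hD' : Tendsto (fun n : ℕ => D' n / (n : ℝ)) atTop (𝓝 d₂)) (hs : d₂ / (2 * R) < s)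
    (hs' : s ≤ 1 / 2) :
    ∀ᶠ n : ℕ in atTop, ∀ B : Finset (Fin ⌊(n : ℝ) * R⌋₊ → Bool),
      (∀ x ∈ B, ∀ y ∈ B, (hammingDist x y : ℝ) ≤ D' n) →
        (B.card : ℝ) ≤ 2 * (2 : ℝ) ^ ((n : ℝ) * (R * h2 s)) := by
  have hs0 : 0 < s := lt_of_le_of_lt (by positivity) hs
  rw [div_lt_iff₀ (by positivity)] at hs
  -- The extra `2 * s` pays for the floor in the codeword length: `D' n + 2 s < 2 s n R < 2 s (l +
  -- 1)`, whence `D' n < 2 s l`.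
  have hlim : Tendsto (fun n : ℕ => D' n / n + 2 * s / n) atTop (𝓝 (d₂ + 0)) :=
    hD'.add (tendsto_const_div_atTop_nhds_zero_nat _)
  have hev := hlim.eventually (gt_mem_nhds (by linarith : d₂ + 0 < s * (2 * R)))
  filter_upwards [hev, eventually_ge_atTop 1] with n hn hn1
  have hn0 : (0 : ℝ) < n := by exact_mod_cast hn1
  rw [← add_div, div_lt_iff₀ hn0] at hn
  set l := ⌊(n : ℝ) * R⌋₊
  intro B hB
  have hlle : (l : ℝ) ≤ n * R := Nat.floor_le (by positivity)
  have hllt : (n : ℝ) * R < l + 1 := Nat.lt_floor_add_one _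
  have hk : ((⌊D' n⌋₊ / 2 : ℕ) : ℝ) ≤ s * l := by
    rcases le_total (D' n) 0 with h | h
    · rw [Nat.floor_of_nonpos h]
      simp only [Nat.zero_div, Nat.cast_zero]
      positivity
    · have h1 : ((⌊D' n⌋₊ / 2 : ℕ) : ℝ) ≤ (⌊D' n⌋₊ : ℝ) / 2 := Nat.cast_div_le
      have h2 := Nat.floor_le h
      nlinarith
  have hc := card_le_of_hammingDist_le ⌊D' n⌋₊ B fun x hx y hy => Nat.le_floor (hB x hx y hy)
  have hc' : (B.card : ℝ) ≤
      2 * ((∑ i ∈ Finset.range (⌊D' n⌋₊ / 2 + 1), l.choose i : ℕ) : ℝ) := by exact_mod_cast hc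
  have hsum := sum_choose_le_two_rpow hs0 hs' hk
  have hexp : (2 : ℝ) ^ ((l : ℝ) * h2 s) ≤ (2 : ℝ) ^ ((n : ℝ) * (R * h2 s)) := by
    refine Real.rpow_le_rpow_of_exponent_le (by norm_num) ?_
    rw [← mul_assoc]
    exact mul_le_mul_of_nonneg_right hlle (h2_nonneg hs0.le (by linarith))
  linarith

lemma Psi_nonneg {d₂ R : ℝ} (hd₂ : 0 ≤ d₂) (hR : 0 < R) : 0 ≤ Psi d₂ R := by
  unfold Psi
  split_ifs with h
  · exact mul_nonneg hR.le (h2_nonneg (by positivity)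
      ((div_le_one (by positivity)).2 (by linarith)))
  · exact hR.le

end Converse

end StableCoding

open StableCoding in
theorem theorem2 (P : PMF Bool) (p : ℝ) (hP : (P true).toReal = p)
    (hp_pos : 0 < p) (hp_half : p ≤ 1 / 2)
    (d₁ d₂ R : ℝ) (D D' : ℕ → ℝ)
    (hd₁ : 0 ≤ d₁) (hd₂ : 0 ≤ d₂)
    (hD : Tendsto (fun n : ℕ => D n / (n : ℝ)) atTop (𝓝 d₁))
    (hD' : Tendsto (fun n : ℕ => D' n / (n : ℝ)) atTop (𝓝 d₂))
    (hd₁p : d₁ / 2 < p)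
    (hR : StableCoding.IsAchievable P StableCoding.letterDist D D' R) :
    StableCoding.h2 (d₁ / 2) ≤ StableCoding.Psi d₂ R := by
  have hR0 := hR.rate_pos hP hp_pos hp_half
  -- For `d₁ = 0` there is no `δ` in `(0, d₁/2)`, but then the left side is `h2 0 = 0`.
  rcases hd₁.eq_or_lt with rfl | hd₁0
  · simpa [h2] using Psi_nonneg hd₂ hR0
  have hδ : ∀ δ, 0 < δ → δ < d₁ / 2 → h2 δ ≤ Psi d₂ R := by
    intro δ h0 h1
    unfold Psi
    split_ifs with hdR
    · have hlt : d₂ / (2 * R) < 1 / 2 := by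
        rw [div_lt_iff₀ (by positivity)]; linarith
      -- The binomial estimate needs `s` strictly above `d₂ / (2R)`, to leave room for convergence
      -- and the floor; continuity of `h2` recovers the endpoint.
      have hlim : Tendsto (fun s => R * h2 s) (𝓝[>] (d₂ / (2 * R)))
          (𝓝 (R * h2 (d₂ / (2 * R)))) :=
        ((continuous_const.mul continuous_h2).tendsto _).mono_left nhdsWithin_le_nhds
      refine ge_of_tendsto hlim ?_
      filter_upwards [Ioo_mem_nhdsGT hlt] with s hs
      exact h2_le_of_eventually_card_le hP hp_half hD hd₁p hR h0 h1
        (eventually_card_le_two_rpow_h2 hR0 hd₂ hD' hs.1 hs.2.le)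
    · exact h2_le_of_eventually_card_le hP hp_half hD hd₁p hR h0 h1
        (Eventually.of_forall fun n B _ => card_le_two_rpow_rate hR0 n B)
  refine le_of_tendsto ((continuous_h2.tendsto (d₁ / 2)).mono_left
    (nhdsWithin_le_nhds (s := Set.Iio (d₁ / 2)))) ?_
  filter_upwards [Ioo_mem_nhdsLT (by linarith : 0 < d₁ / 2)] with δ h
  exact hδ δ h.1 h.2
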